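/- Theorem. Let $\sigma$ be a finite relational signature and let $\mathbf S,\mathbf T$ be finite $\sigma$-structures with domains $S\neq\emptyset$ and $T$ such that there is a homomorphism $\mathbf S\to\mathbf T$ (i.e. $(\mathbf S,\mathbf T)$ is a PCSP template). A *$k$-strategy* on a finite $\sigma$-structure $\mathbf I$ and $\mathbf S$ is a non-empty collection $\mathcal H$ of partial homomorphisms from $\mathbf I$ to $\mathbf S$ (maps $h:X\to S$ with $X\subseteq I$ that are homomorphisms from the induced substructure $\mathbf I|_X$ to $\mathbf S$) that is closed under restrictions and such that for every $h\in\mathcal H$ with $|\mathrm{dom}(h)|<k$ and every $x\in I\setminus \mathrm{dom}(h)$ there is $f\in\mathcal H$ extending $h$ with $\mathrm{dom}(f)=\mathrm{dom}(h)\cup\{x\}$. The template $(\mathbf S,\mathbf T)$ has *width* $k(n)$ if every finite $\sigma$-structure $\mathbf I$, with $n$ elements, that admits a $k(n)$-strategy on $\mathbf I$ and $\mathbf S$ has a homomorphism to $\mathbf T$. It has *sublinear width* if it has width $k(n)$ for some $k(n)=o(n)$, and *bounded width* if it has width $k(n)$ for some $k(n)=O(1)$. Let $P=\prod_{R\in\sigma}R^{\mathbf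 S}$ be the product of all relations of $\mathbf S$, of arity $r$ equal to the sum of the arities of the symbols of $\sigma$, and let $\mathcal G(\mathbf S)=\{\mathrm{pr}_{(i,j)}P : i,j\in\{1,\dots,r\},\ i\neq j\}$, where $\mathrm{pr}_{(i,j)}P=\{(t(i),t(j)) : t\in P\}$. For $U,V\subseteq S^2$ let $U\circ V=\{(a,b) : \exists c,\ (a,c)\in U,\ (c,b)\in V\}$. Suppose that $U\circ V=S^2$ for all $U,V\in\mathcal G(\mathbf S)$. In the degenerate case $r\le 1$ (in which $\mathcal G(\mathbf S)=\emptyset$) suppose in addition that every relation of $\mathbf T$ is non-empty. If $(\mathbf S,\mathbf T)$ has sublinear width, then $\mathbf T$ is reflexive: there is $a\in T$ such that every relation of $\mathbf T$ contains the tuple $(a,a,\dots,a)$. In particular, the same conclusion holds if $(\mathbf S,\mathbf T)$ has bounded width. -/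

import Mathlib

open FirstOrder FirstOrder.Language Filter

/-!
Relational signatures are relational first-order languages with finitely many relation symbols,
relational structures are their structures, and `A →[L] B` is the type of homomorphisms
(maps that preserve all relations).
-/

namespace PCSP

/-- The signature `L` consists of finitely many relation symbols and no function symbols. -/
structure IsFiniteSignature (L : FirstOrder.Language) : Prop where
  relational : L.IsRelational
  finite : Finite (Σ n, L.Relations n)

/-- The coordinates of the product of all relations of an `L`-structure: one coordinate for
every relation symbol `R` and every argument place of `R`. -/
abbrev Coord (L : FirstOrder.Language) : Type _ :=
  Σ R : (Σ n, L.Relations n), Fin R.1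

/-- The product, over all relation symbols of `L`, of the relations of the structure `A`. Its
arity is the sum of the arities of the symbols. -/
def prodRel (L : FirstOrder.Language) (A : Type*) [L.Structure A] : Set (Coord L → A) :=
  {t | ∀ R : (Σ n, L.Relations n), Structure.RelMap R.2 (fun i : Fin R.1 => t ⟨R, i⟩)}

/-- The projection of a relation on the pair `(i, j)` of coordinates. -/
def binaryProj {ι A : Type*} (P : Set (ι → A)) (i j : ι) : SetRel A A :=
  {ab | ∃ t ∈ P, t i = ab.1 ∧ t j = ab.2}

/-- The set of all binary projections, on ordered pairs of distinct coordinates, of the product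
of the relations of `A`. -/
def binaryProjections (L : FirstOrder.Language) (A : Type*) [L.Structure A] :
    Set (SetRel A A) :=
  {U | ∃ i j : Coord L, i ≠ j ∧ U = binaryProj (prodRel L A) i j}

/-- `h : X → S` is a partial homomorphism from `I` to `S`, i.e. a homomorphism to `S` from the
substructure of `I` induced by the set `X`. -/
def IsPartialHom (L : FirstOrder.Language) {I S : Type*} [L.Structure I] [L.Structure S]
    (X : Set I) (h : X → S) : Prop :=
  ∀ (n : ℕ) (R : L.Relations n) (t : Fin n → X),
    Structure.RelMap R (fun i => (t i : I)) → Structure.RelMap R (fun i => h (t i))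

/-- A `k`-strategy on `I` and `S`. The collection is given by the sets `H X` of those of its
members that have domain `X`. -/
structure IsStrategy (L : FirstOrder.Language) {I S : Type*} [Finite I] [L.Structure I]
    [L.Structure S] (k : ℕ) (H : (X : Set I) → Set (X → S)) : Prop where
  nonempty : ∃ X : Set I, (H X).Nonempty
  isPartialHom : ∀ (X : Set I), ∀ h ∈ H X, IsPartialHom L X h
  restrict : ∀ (X Y : Set I) (hYX : Y ⊆ X), ∀ h ∈ H X, h ∘ Set.inclusion hYX ∈ H Y
  extend : ∀ (X : Set I), ∀ h ∈ H X, X.ncard < k → ∀ x ∉ X,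
    ∃ f ∈ H (insert x X), f ∘ Set.inclusion (Set.subset_insert x X) = h

/-- There is a `k`-strategy on `I` and `S`. -/
def Consistent (L : FirstOrder.Language) (k : ℕ) (I S : Type*) [Finite I] [L.Structure I]
    [L.Structure S] : Prop :=
  ∃ H : (X : Set I) → Set (X → S), IsStrategy L k H

/-- `(S, T)` has width `k(n)`: every finite instance `I` with `n` elements on which there is a
`k(n)`-strategy into `S` is homomorphic to `T`. -/
def HasWidth (L : FirstOrder.Language) (S T : Type*) [L.Structure S] [L.Structure T]
    (k : ℕ → ℕ) : Prop :=
  ∀ (I : Type) [Finite I] [L.Structure I],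
    Consistent L (k (Nat.card I)) I S → Nonempty (I →[L] T)

/-- `(S, T)` has width `k(n)` for some `k(n) = o(n)`. -/
def HasSublinearWidth (L : FirstOrder.Language) (S T : Type*) [L.Structure S]
    [L.Structure T] : Prop :=
  ∃ k : ℕ → ℕ, (fun n => (k n : ℝ)) =o[atTop] (fun n => (n : ℝ)) ∧ HasWidth L S T k

/-- `(S, T)` has width `k(n)` for some `k(n) = O(1)`. -/
def HasBoundedWidth (L : FirstOrder.Language) (S T : Type*) [L.Structure S]
    [L.Structure T] : Prop :=
  ∃ k : ℕ → ℕ, (fun n => (k n : ℝ)) =O[atTop] (fun _ => (1 : ℝ)) ∧ HasWidth L S T k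

/-- Some element `a` is such that every relation of `T` contains the tuple `(a, …, a)`. -/
def IsReflexive (L : FirstOrder.Language) (T : Type*) [L.Structure T] : Prop :=
  ∃ a : T, ∀ (n : ℕ) (R : L.Relations n), Structure.RelMap R (fun _ => a)

end PCSP

/-! Let `r` be the number of coordinates. An `r`-uniform hypergraph with ordered edges becomes an
instance by requiring every edge to map into the product of the relations. A random hypergraph on `n
= a * |T|` vertices with `K * n` edges has, with positive probability, two properties: every set of
`a` vertices contains an edge, and every set of `m ≤ n / M` edges spans at least `(r - 1 - 1/q) * m`
vertices (`exists_sparse_hypergraph`).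

By the first property and pigeonhole, a homomorphism to `T` is constant on some edge, so `T` is
reflexive (`isReflexive_of_hom`).

The second property yields a strategy (`consistent_hypergraphStructure`). A sparse set of more than
`q * |X|` edges contains an edge with at most one non-free vertex, or two meeting edges that
together form a path with only its ends constrained. Such edges can be removed and later satisfied
again, because compositions of binary projections are full. Hence an assignment on `X` that extends
to every set of at most `q * |X|` edges extends to every set of at most `n / M` edges
(`Extends.of_forall_card_le`). This slack is linear in `n`, so it accommodates every `k = o(n)`. -/

namespace PCSP

/-! ### Adding edges back to a partial solution. -/

section Hypergraph

variable {V E ι S : Type*}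

/-- The assignment `h` of the vertices in `X` extends to one that sends all edges in `F` to `P`. -/
def Extends (e : E → ι ↪ V) (P : Set (ι → S)) (X : Set V) (h : X → S) (F : Finset E) : Prop :=
  ∃ g : V → S, (∀ x : X, g x = h x) ∧ ∀ j ∈ F, (fun i => g (e j i)) ∈ P

/-- The `i`-th vertex of the edge `j` is outside `X` and lies in no other edge of `F`. -/
def IsFree (e : E → ι ↪ V) (X : Set V) (F : Finset E) (j : E) (i : ι) : Prop :=
  e j i ∉ X ∧ ∀ j' ∈ F, ∀ i', e j' i' = e j i → j' = j

theorem extend_eq_of_forall {f : ι ↪ V} {t : ι → S} {g : V → S} {v : V}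
    (h : ∀ i, f i = v → t i = g v) : Function.extend f t g v = g v := by
  by_cases hv : ∃ i, f i = v
  · obtain ⟨i, rfl⟩ := hv
    rw [f.injective.extend_apply, h i rfl]
  · exact Function.extend_apply' _ _ _ hv

/-- An edge with at most one vertex that is not free can be added. -/
theorem Extends.of_erase [DecidableEq E] {e : E → ι ↪ V} {P : Set (ι → S)} {X : Set V}
    {h : X → S} {F : Finset E} {j : E} {i₀ : ι}
    (hP : ∀ a : S, ∃ t ∈ P, t i₀ = a)
    (hfree : ∀ i, i ≠ i₀ → IsFree e X F j i)
    (hF : Extends e P X h (F.erase j)) : Extends e P X h F := by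
  obtain ⟨g, h1, h2⟩ := hF
  obtain ⟨t, ht, hti⟩ := hP (g (e j i₀))
  have key : ∀ v, (v ∈ X ∨ ∃ j' ∈ F.erase j, ∃ i', e j' i' = v) →
      Function.extend (e j) t g v = g v := by
    intro v hv
    refine extend_eq_of_forall fun i hi => ?_
    by_cases h0 : i = i₀
    · subst h0; rw [← hi]; exact hti
    · exfalso
      obtain ⟨hX, hj⟩ := hfree i h0
      rcases hv with hv | ⟨j', hj', i', hv⟩
      · exact hX (hi ▸ hv)
      · exact (Finset.mem_erase.1 hj').1 (hj j' (Finset.mem_erase.1 hj').2 i' (hv.trans hi.symm))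
  refine ⟨Function.extend (e j) t g, fun x => ?_, fun j' hj' => ?_⟩
  · rw [key x (Or.inl x.2), h1]
  · by_cases hjj : j' = j
    · subst hjj
      simpa only [(e j').injective.extend_apply] using ht
    · have hm := Finset.mem_erase.2 ⟨hjj, hj'⟩
      have : (fun i => Function.extend (e j) t g (e j' i)) = fun i => g (e j' i) :=
        funext fun i => key _ (Or.inr ⟨j', hm, i, rfl⟩)
      rw [this]
      exact h2 j' hm

/-- Two edges that meet in a vertex of degree two outside `X`, and that both have only one
further vertex that is not free, can be added. -/
theorem Extends.of_erase_erase [DecidableEq E] {e : E → ι ↪ V} {P : Set (ι → S)} {X : Set V}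
    {h : X → S} {F : Finset E} {j₁ j₂ : E} {c₁ x₁ c₂ x₂ : ι} (hj : j₁ ≠ j₂) (hj₁ : j₁ ∈ F)
    (hj₂ : j₂ ∈ F)
    (hP : ∀ a b : S, ∃ t₁ ∈ P, ∃ t₂ ∈ P, t₁ x₁ = a ∧ t₁ c₁ = t₂ c₂ ∧ t₂ x₂ = b)
    (hx₁ : x₁ ≠ c₁) (hx₂ : x₂ ≠ c₂) (hc : e j₁ c₁ = e j₂ c₂) (hcX : e j₁ c₁ ∉ X)
    (hcF : ∀ j ∈ F, ∀ i, e j i = e j₁ c₁ → j = j₁ ∨ j = j₂)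
    (hfree₁ : ∀ i, i ≠ c₁ → i ≠ x₁ → IsFree e X F j₁ i)
    (hfree₂ : ∀ i, i ≠ c₂ → i ≠ x₂ → IsFree e X F j₂ i)
    (hF : Extends e P X h ((F.erase j₁).erase j₂)) : Extends e P X h F := by
  obtain ⟨g, h1, h2⟩ := hF
  obtain ⟨t₁, ht₁, t₂, ht₂, hta, htc, htb⟩ := hP (g (e j₁ x₁)) (g (e j₂ x₂))
  have key₂ : ∀ v, (v ∈ X ∨ ∃ j' ∈ F, j' ≠ j₁ ∧ j' ≠ j₂ ∧ ∃ i', e j' i' = v) →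
      Function.extend (e j₂) t₂ g v = g v := by
    intro v hv
    refine extend_eq_of_forall fun i hi => ?_
    by_cases hx : i = x₂
    · subst hx; rw [← hi]; exact htb
    exfalso
    by_cases hc' : i = c₂
    · subst hc'
      rcases hv with hv | ⟨j', hj', hn₁, hn₂, i', hv⟩
      · rw [← hi, ← hc] at hv; exact hcX hv
      · rcases hcF j' hj' i' (by rw [hv, hc, hi]) with h | h
        · exact hn₁ h
        · exact hn₂ h
    · obtain ⟨hX, hu⟩ := hfree₂ i hc' hx
      rcases hv with hv | ⟨j', hj', hn₁, hn₂, i', hv⟩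
      · exact hX (hi ▸ hv)
      · exact hn₂ (hu j' hj' i' (hv.trans hi.symm))
  have key₁ : ∀ v, (v ∈ X ∨ ∃ j' ∈ F, j' ≠ j₁ ∧ j' ≠ j₂ ∧ ∃ i', e j' i' = v) →
      Function.extend (e j₁) t₁ (Function.extend (e j₂) t₂ g) v = g v := by
    intro v hv
    rw [← key₂ v hv]
    refine extend_eq_of_forall fun i hi => ?_
    rw [key₂ v hv]
    by_cases hx : i = x₁
    · subst hx; rw [← hi]; exact hta
    exfalso
    by_cases hc' : i = c₁
    · subst hc'
      rcases hv with hv | ⟨j', hj', hn₁, hn₂, i', hv⟩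
      · rw [← hi] at hv; exact hcX hv
      · rcases hcF j' hj' i' (by rw [hv, hi]) with h | h
        · exact hn₁ h
        · exact hn₂ h
    · obtain ⟨hX, hu⟩ := hfree₁ i hc' hx
      rcases hv with hv | ⟨j', hj', hn₁, hn₂, i', hv⟩
      · exact hX (hi ▸ hv)
      · exact hn₁ (hu j' hj' i' (hv.trans hi.symm))
  -- Writing `t₁` last does not damage `j₂`: the tuples agree at the common vertex, and if the outer
  -- ends `x₁`, `x₂` are the same vertex, both tuples carry the value of `g` there.
  have keyj : ∀ i, Function.extend (e j₁) t₁ (Function.extend (e j₂) t₂ g) (e j₂ i) = t₂ i := by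
    intro i
    have hi₂ : Function.extend (e j₂) t₂ g (e j₂ i) = t₂ i := (e j₂).injective.extend_apply _ _ _
    rw [← hi₂]
    refine extend_eq_of_forall fun i' hi' => ?_
    rw [hi₂]
    by_cases hc' : i' = c₁
    · subst hc'
      rw [htc, (e j₂).injective (hc.symm.trans hi')]
    by_cases hx : i' = x₁
    · subst hx
      have hic : i ≠ c₂ := by
        rintro rfl
        exact hx₁ ((e j₁).injective (hi'.trans hc.symm))
      by_cases hix : i = x₂
      · subst hix
        rw [hta, htb, hi']
      · exact absurd ((hfree₂ i hic hix).2 j₁ hj₁ i' hi') hj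
    · exact absurd ((hfree₁ i' hc' hx).2 j₂ hj₂ i hi'.symm) hj.symm
  refine ⟨Function.extend (e j₁) t₁ (Function.extend (e j₂) t₂ g), fun x => ?_,
    fun j' hj' => ?_⟩
  · rw [key₁ x (Or.inl x.2), h1]
  · by_cases hn₁ : j' = j₁
    · subst hn₁
      simpa only [(e j').injective.extend_apply] using ht₁
    by_cases hn₂ : j' = j₂
    · subst hn₂
      simpa only [keyj] using ht₂
    have : (fun i => Function.extend (e j₁) t₁ (Function.extend (e j₂) t₂ g) (e j' i)) =
        fun i => g (e j' i) :=
      funext fun i => key₁ _ (Or.inr ⟨j', hj', hn₁, hn₂, i, rfl⟩)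
    rw [this]
    exact h2 j' (Finset.mem_erase.2 ⟨hn₂, Finset.mem_erase.2 ⟨hn₁, hj'⟩⟩)

end Hypergraph

/-! ### Discharging: large sparse edge sets are reducible. -/

section Reducible

variable {V E ι S : Type*}

/-- The vertices of the edges in `F`. -/
def vertices [Fintype ι] [DecidableEq V] (e : E → ι ↪ V) (F : Finset E) : Finset V :=
  F.biUnion fun j => Finset.univ.map (e j)

open Classical in
/-- The number of edges in `F` that contain `v`. -/
noncomputable def edgeDegree (e : E → ι ↪ V) (F : Finset E) (v : V) : ℕ :=
  (F.filter fun j => ∃ i, e j i = v).card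

theorem edgeDegree_pos {e : E → ι ↪ V} {F : Finset E} {v : V} {j : E} (hj : j ∈ F)
    (hv : ∃ i, e j i = v) : 0 < edgeDegree e F v := by
  classical
  exact Finset.card_pos.2 ⟨j, Finset.mem_filter.2 ⟨hj, hv⟩⟩

/-- Double counting of incidences; edges are injective, so each contributes a vertex at most once.
-/
theorem sum_sum_eq_sum_edgeDegree [Fintype ι] [DecidableEq V] (e : E → ι ↪ V) (F : Finset E)
    (f : V → ℕ) :
    ∑ j ∈ F, ∑ i, f (e j i) = ∑ v ∈ vertices e F, edgeDegree e F v * f v := by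
  classical
  have h1 : ∀ j ∈ F, ∑ i, f (e j i) =
      ∑ v ∈ vertices e F, if ∃ i, e j i = v then f v else 0 := by
    intro j hj
    rw [← Finset.sum_filter]
    have : (vertices e F).filter (fun v => ∃ i, e j i = v) = Finset.univ.map (e j) := by
      ext v
      simp only [vertices, Finset.mem_filter, Finset.mem_biUnion, Finset.mem_map,
        Finset.mem_univ, true_and]
      exact ⟨fun h => h.2, fun h => ⟨⟨j, hj, h⟩, h⟩⟩
    rw [this, Finset.sum_map]
  rw [Finset.sum_congr rfl h1, Finset.sum_comm]
  refine Finset.sum_congr rfl fun v _ => ?_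
  rw [← Finset.sum_filter, Finset.sum_const, smul_eq_mul, edgeDegree]
  congr!

/-- For edges of `F`, freeness depends only on the vertex, which allows discharging with vertex
weights. -/
theorem not_isFree_iff {e : E → ι ↪ V} {X : Set V} {F : Finset E} {j : E} (hj : j ∈ F) (i : ι) :
    ¬ IsFree e X F j i ↔ e j i ∈ X ∨ 2 ≤ edgeDegree e F (e j i) := by
  classical
  have hmem : j ∈ F.filter fun j' => ∃ i', e j' i' = e j i :=
    Finset.mem_filter.2 ⟨hj, i, rfl⟩
  rw [IsFree, not_and_or, not_not, edgeDegree, ← Nat.lt_iff_add_one_le, Finset.one_lt_card_iff]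
  refine or_congr_right ⟨fun h => ?_, ?_⟩
  · push Not at h
    obtain ⟨j', hj', i', hi', hne⟩ := h
    exact ⟨j', j, Finset.mem_filter.2 ⟨hj', i', hi'⟩, hmem, hne⟩
  · rintro ⟨a, b, ha, hb, hab⟩ h
    obtain ⟨ha, ia, hia⟩ := Finset.mem_filter.1 ha
    obtain ⟨hb, ib, hib⟩ := Finset.mem_filter.1 hb
    exact hab ((h a ha ia hia).trans (h b hb ib hib).symm)

/-- The edge `j` has exactly two vertices that are not free, and both of them lie outside `X` and
in exactly two edges of `F`. -/
def IsLight (e : E → ι ↪ V) (X : Set V) (F : Finset E) (j : E) : Prop :=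
  ∃ c x, c ≠ x ∧ (∀ i, ¬ IsFree e X F j i ↔ i = c ∨ i = x) ∧
    ∀ i, ¬ IsFree e X F j i → e j i ∉ X ∧ edgeDegree e F (e j i) = 2

theorem eq_or_eq_of_edgeDegree_eq_two {e : E → ι ↪ V} {F : Finset E} {v : V}
    (hv : edgeDegree e F v = 2) {j₁ j₂ j : E} (h₁ : j₁ ∈ F) (h₂ : j₂ ∈ F) (h : j ∈ F)
    (hne : j₁ ≠ j₂) (hi₁ : ∃ i, e j₁ i = v) (hi₂ : ∃ i, e j₂ i = v) (hi : ∃ i, e j i = v) :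
    j = j₁ ∨ j = j₂ := by
  classical
  have hsub : {j₁, j₂} ⊆ F.filter fun j => ∃ i, e j i = v := by
    intro a ha
    rcases Finset.mem_insert.1 ha with rfl | ha
    · exact Finset.mem_filter.2 ⟨h₁, hi₁⟩
    · rw [Finset.mem_singleton.1 ha]
      exact Finset.mem_filter.2 ⟨h₂, hi₂⟩
  have heq := Finset.eq_of_subset_of_card_le hsub
    (by rw [Finset.card_pair hne]; exact hv.le)
  have : j ∈ ({j₁, j₂} : Finset E) := heq ▸ Finset.mem_filter.2 ⟨h, hi⟩
  simpa using this

theorem exists_other_of_not_isFree {e : E → ι ↪ V} {X : Set V} {F : Finset E} {j : E} {i : ι}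
    (hX : e j i ∉ X) (h : ¬ IsFree e X F j i) : ∃ j' ∈ F, ∃ i', e j' i' = e j i ∧ j' ≠ j := by
  rw [IsFree, not_and_or, not_not] at h
  rcases h with h | h
  · exact absurd h hX
  · push Not at h
    exact h

/-- If no two light edges meet, then the light edges are at most `|ι|` times as many as the
others. -/
theorem card_light_le [Fintype ι] [DecidableEq E] {e : E → ι ↪ V} {X : Set V}
    {F L : Finset E} (hL : ∀ j, j ∈ L ↔ j ∈ F ∧ IsLight e X F j)
    (hmeet : ∀ j₁ ∈ L, ∀ j₂ ∈ L, j₁ ≠ j₂ → ∀ i₁ i₂, e j₁ i₁ ≠ e j₂ i₂) :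
    L.card ≤ Fintype.card ι * (F \ L).card := by
  classical
  have hex : ∀ j ∈ L, ∃ p : E × ι, p.1 ∈ F \ L ∧ edgeDegree e F (e p.1 p.2) = 2 ∧
      ∃ c, e j c = e p.1 p.2 := by
    intro j hj
    obtain ⟨hjF, c, x, -, hcx, hdeg⟩ := (hL j).1 hj
    have hc := (hcx c).2 (Or.inl rfl)
    obtain ⟨j', hj', i', hi', hne⟩ := exists_other_of_not_isFree (hdeg c hc).1 hc
    refine ⟨(j', i'), Finset.mem_sdiff.2 ⟨hj', fun hj'L => ?_⟩, ?_, c, hi'.symm⟩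
    · exact hmeet j' hj'L j hj hne i' c hi'
    · rw [hi']; exact (hdeg c hc).2
  rcases L.eq_empty_or_nonempty with hemp | ⟨j₀, hj₀⟩
  · simp [hemp]
  have : Nonempty (E × ι) := ⟨(hex j₀ hj₀).choose⟩
  choose! p hp using hex
  -- Each light edge is charged to a position in a non-light edge. This is injective: a vertex of
  -- degree two in a non-light edge lies in at most one light edge.
  have hle : L.card ≤ ((F \ L) ×ˢ (Finset.univ : Finset ι)).card := by
    refine Finset.card_le_card_of_injOn p
      (fun j hj => Finset.mem_coe.2 (Finset.mem_product.2 ⟨(hp j hj).1, Finset.mem_univ _⟩)) ?_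
    intro j₁ h₁ j₂ h₂ h
    obtain ⟨hm, hd, hc₁⟩ := hp j₁ h₁
    obtain ⟨-, -, hc₂⟩ := hp j₂ h₂
    rw [← h] at hc₂
    by_contra hne
    rcases eq_or_eq_of_edgeDegree_eq_two hd ((hL _).1 h₁).1 ((hL _).1 h₂).1
      (Finset.mem_sdiff.1 hm).1 hne hc₁ hc₂ ⟨_, rfl⟩ with h' | h'
    · exact (Finset.mem_sdiff.1 hm).2 (by rw [h']; exact h₁)
    · exact (Finset.mem_sdiff.1 hm).2 (by rw [h']; exact h₂)
  rw [Finset.card_product, Finset.card_univ, mul_comm] at hle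
  exact hle

/-- If every edge has two vertices that are not free, then a set of edges spans few vertices,
unless most of its edges are light. -/
theorem card_add_card_le [Fintype ι] [DecidableEq V] [DecidableEq E] {e : E → ι ↪ V}
    {X : Finset V} {F L : Finset E} (hL : ∀ j, j ∈ L ↔ j ∈ F ∧ IsLight e X F j)
    (hfree : ∀ j ∈ F, ∀ i₀, ∃ i, i ≠ i₀ ∧ ¬ IsFree e (X : Set V) F j i) [Nonempty ι] :
    6 * F.card + (F \ L).card + 6 * (vertices e F).card ≤
      6 * (Fintype.card ι * F.card) + 6 * X.card := by
  classical
  -- Free vertices weigh 0, vertices outside `X` of degree two weigh 3, all others 4. An edge then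
  -- weighs at least 6, and at least 7 unless it is light. A vertex of degree `d` outside `X`
  -- absorbs at most `6 * d - 6`, with equality for `d = 1, 2, 3`.
  let w : V → ℕ := fun v => (if v ∈ X ∨ 2 ≤ edgeDegree e F v then 3 else 0) +
    (if v ∈ X ∨ 3 ≤ edgeDegree e F v then 1 else 0)
  have hw : ∀ j ∈ F, ∀ i, ¬ IsFree e (X : Set V) F j i → 3 ≤ w (e j i) := by
    intro j hj i hi
    rw [not_isFree_iff hj, Finset.mem_coe] at hi
    simp only [w, if_pos hi]
    omega
  have hlow : ∀ j ∈ F, 6 + (if j ∈ L then 0 else 1) ≤ ∑ i, w (e j i) := by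
    intro j hj
    obtain ⟨c, -, hc⟩ := hfree j hj (Classical.arbitrary ι)
    obtain ⟨x, hxc, hx⟩ := hfree j hj c
    have hsub : ∀ s : Finset ι, ∑ i ∈ s, w (e j i) ≤ ∑ i, w (e j i) := fun s =>
      Finset.sum_le_sum_of_subset (Finset.subset_univ s)
    have h6 := hsub {c, x}
    rw [Finset.sum_pair hxc.symm] at h6
    have hc3 := hw j hj c hc
    have hx3 := hw j hj x hx
    split_ifs with hjL
    · omega
    by_contra hlt
    push Not at hlt
    refine hjL ((hL j).2 ⟨hj, c, x, hxc.symm, fun i => ⟨fun hi => ?_, ?_⟩, fun i hi => ?_⟩)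
    · by_contra hne
      push Not at hne
      have h9 := hsub {i, c, x}
      rw [Finset.sum_insert (by simp [hne.1, hne.2]), Finset.sum_pair hxc.symm] at h9
      have := hw j hj i hi
      omega
    · rintro (rfl | rfl) <;> assumption
    · by_contra hne
      have h4 : 4 ≤ w (e j i) := by
        rw [not_isFree_iff hj, Finset.mem_coe] at hi
        have : e j i ∈ X ∨ 3 ≤ edgeDegree e F (e j i) := by
          by_contra hcon
          push Not at hcon
          refine hne ⟨hcon.1, ?_⟩
          rcases hi with hi | hi
          · exact absurd hi hcon.1
          · omega
        simp only [w, if_pos hi, if_pos this]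
        omega
      by_cases hic : i = c
      · subst hic; omega
      · have h7 := hsub {i, c}
        rw [Finset.sum_pair hic] at h7
        omega
  have hup : ∀ v ∈ vertices e F, edgeDegree e F v * w v + 6 ≤
      edgeDegree e F v * 6 + (if v ∈ X then 6 else 0) := by
    intro v hv
    have hd : 1 ≤ edgeDegree e F v := by
      simp only [vertices, Finset.mem_biUnion, Finset.mem_map, Finset.mem_univ, true_and] at hv
      obtain ⟨j, hj, hi⟩ := hv
      exact edgeDegree_pos hj hi
    by_cases hX : v ∈ X
    · simp only [w, hX, true_or, if_true]; omega
    · simp only [w, hX, false_or, if_false]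
      split_ifs <;> omega
  have h1 := Finset.sum_le_sum hlow
  rw [sum_sum_eq_sum_edgeDegree e F w, Finset.sum_add_distrib, Finset.sum_const,
    smul_eq_mul] at h1
  have h2 := Finset.sum_le_sum hup
  rw [Finset.sum_add_distrib, Finset.sum_add_distrib, Finset.sum_const, smul_eq_mul,
    ← sum_sum_eq_sum_edgeDegree e F (fun _ => 6)] at h2
  simp only [Finset.sum_const, Finset.card_univ, smul_eq_mul] at h2
  have h3 : ∑ v ∈ vertices e F, (if v ∈ X then 6 else 0) ≤ X.card * 6 := by
    rw [← Finset.sum_filter, Finset.sum_const, smul_eq_mul]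
    exact Nat.mul_le_mul_right _
      (Finset.card_le_card fun v hv => (Finset.mem_filter.1 hv).2)
  have h4 : ∑ j ∈ F, (if j ∈ L then 0 else 1) = (F \ L).card := by
    rw [← Finset.filter_notMem_eq_sdiff, Finset.card_filter]
    exact Finset.sum_congr rfl fun j _ => by split_ifs <;> simp_all
  rw [h4] at h1
  have h5 : F.card * (Fintype.card ι * 6) = 6 * (Fintype.card ι * F.card) := by ring
  omega

/-- A large sparse set of edges has an edge or a pair of edges as in `Extends.of_erase` and
`Extends.of_erase_erase`. -/
theorem Extends.of_sparse [Fintype ι] [Nontrivial ι] [DecidableEq V] [DecidableEq E]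
    {e : E → ι ↪ V} {P : Set (ι → S)} {X : Finset V} {h : ↥(X : Set V) → S} {F : Finset E} {q : ℕ}
    (hq : q = 12 * (Fintype.card ι + 1))
    (hP : ∀ i j i' j' : ι, i ≠ j → i' ≠ j' →
      ∀ a b : S, ∃ t₁ ∈ P, ∃ t₂ ∈ P, t₁ i = a ∧ t₁ j = t₂ i' ∧ t₂ j' = b)
    (hsparse : q * (Fintype.card ι * F.card) ≤ q * (vertices e F).card + (q + 1) * F.card)
    (hX : q * X.card < F.card)
    (hF : ∀ G, G ⊂ F → Extends e P X h G) : Extends e P X h F := by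
  classical
  by_cases hfree : ∀ j ∈ F, ∀ i₀, ∃ i, i ≠ i₀ ∧ ¬ IsFree e (X : Set V) F j i
  · let L := F.filter (IsLight e X F)
    have hL : ∀ j, j ∈ L ↔ j ∈ F ∧ IsLight e X F j := fun j => Finset.mem_filter
    by_cases hmeet : ∀ j₁ ∈ L, ∀ j₂ ∈ L, j₁ ≠ j₂ → ∀ i₁ i₂, e j₁ i₁ ≠ e j₂ i₂
    · exfalso
      have h1 := card_light_le hL hmeet
      have h2 := card_add_card_le hL hfree
      have h3 : (F \ L).card + L.card = F.card :=
        Finset.card_sdiff_add_card_eq_card (Finset.filter_subset _ _)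
      generalize Fintype.card ι = r at *
      generalize (F \ L).card = b at *
      generalize L.card = l at *
      generalize F.card = m at *
      generalize (vertices e F).card = u at *
      generalize X.card = k at *
      -- The choice of `q` pays off here: `12 * m ≤ q * b ≤ 6 * m + 6 * q * k < 12 * m`.
      have h4 : m ≤ (r + 1) * b := by nlinarith
      have h5 : q * b ≤ 6 * m + 6 * (q * k) := by nlinarith
      have h6 : q * b = 12 * ((r + 1) * b) := by rw [hq]; ring
      omega
    · push Not at hmeet
      obtain ⟨j₁, hj₁, j₂, hj₂, hne, c₁, c₂, hc⟩ := hmeet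
      obtain ⟨hj₁, a₁, b₁, hab₁, hcx₁, hdeg₁⟩ := (hL j₁).1 hj₁
      obtain ⟨hj₂, a₂, b₂, hab₂, hcx₂, hdeg₂⟩ := (hL j₂).1 hj₂
      have hn₁ : ¬ IsFree e (X : Set V) F j₁ c₁ := fun hf => hne (hf.2 j₂ hj₂ c₂ hc.symm).symm
      have hn₂ : ¬ IsFree e (X : Set V) F j₂ c₂ := fun hf => hne (hf.2 j₁ hj₁ c₁ hc)
      have hx₁ : ∃ x, x ≠ c₁ ∧ ∀ i, i ≠ c₁ → i ≠ x → IsFree e (X : Set V) F j₁ i := by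
        rcases (hcx₁ c₁).1 hn₁ with rfl | rfl
        · exact ⟨b₁, hab₁.symm, fun i h h' => not_not.1 fun hi => ((hcx₁ i).1 hi).elim h h'⟩
        · exact ⟨a₁, hab₁, fun i h h' => not_not.1 fun hi => ((hcx₁ i).1 hi).elim h' h⟩
      have hx₂ : ∃ x, x ≠ c₂ ∧ ∀ i, i ≠ c₂ → i ≠ x → IsFree e (X : Set V) F j₂ i := by
        rcases (hcx₂ c₂).1 hn₂ with rfl | rfl
        · exact ⟨b₂, hab₂.symm, fun i h h' => not_not.1 fun hi => ((hcx₂ i).1 hi).elim h h'⟩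
        · exact ⟨a₂, hab₂, fun i h h' => not_not.1 fun hi => ((hcx₂ i).1 hi).elim h' h⟩
      obtain ⟨x₁, hx₁, hf₁⟩ := hx₁
      obtain ⟨x₂, hx₂, hf₂⟩ := hx₂
      refine Extends.of_erase_erase hne hj₁ hj₂ (hP x₁ c₁ c₂ x₂ hx₁ hx₂.symm) hx₁ hx₂ hc
        (hdeg₁ c₁ hn₁).1 (fun j hj i hi => ?_) hf₁ hf₂ (hF _ ?_)
      · exact eq_or_eq_of_edgeDegree_eq_two (hdeg₁ c₁ hn₁).2 hj₁ hj₂ hj hne ⟨c₁, rfl⟩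
          ⟨c₂, hc.symm⟩ ⟨i, hi⟩
      · exact (Finset.erase_subset _ _).trans_ssubset (Finset.erase_ssubset hj₁)
  · push Not at hfree
    obtain ⟨j, hj, i₀, hi₀⟩ := hfree
    obtain ⟨i₁, hi₁⟩ := exists_ne i₀
    refine Extends.of_erase (i₀ := i₀) (fun a => ?_) hi₀ (hF _ (Finset.erase_ssubset hj))
    obtain ⟨t, ht, -, -, hta, -⟩ := hP i₀ i₁ i₀ i₁ hi₁.symm hi₁.symm a a
    exact ⟨t, ht, hta⟩

/-- In a locally sparse hypergraph, it suffices to extend an assignment to few edges. -/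
theorem Extends.of_forall_card_le [Fintype ι] [Nontrivial ι] [DecidableEq V] [DecidableEq E]
    {e : E → ι ↪ V} {P : Set (ι → S)} {X : Finset V} {h : ↥(X : Set V) → S} {q B : ℕ}
    (hq : q = 12 * (Fintype.card ι + 1))
    (hP : ∀ i j i' j' : ι, i ≠ j → i' ≠ j' →
      ∀ a b : S, ∃ t₁ ∈ P, ∃ t₂ ∈ P, t₁ i = a ∧ t₁ j = t₂ i' ∧ t₂ j' = b)
    (hsparse : ∀ F : Finset E, F.card ≤ B →
      q * (Fintype.card ι * F.card) ≤ q * (vertices e F).card + (q + 1) * F.card)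
    (hX : ∀ G : Finset E, G.card ≤ q * X.card → Extends e P X h G)
    (F : Finset E) (hF : F.card ≤ B) : Extends e P X h F := by
  induction F using Finset.strongInduction with
  | H F ih =>
    by_cases hc : F.card ≤ q * X.card
    · exact hX F hc
    · exact Extends.of_sparse hq hP (hsparse F hF) (not_le.1 hc)
        fun G hG => ih G hG ((Finset.card_le_card hG.1).trans hF)

end Reducible

/-! ### First-moment estimates for random hypergraphs. -/

section Counting

theorem card_embedding_into {ι V : Type*} [Fintype ι] [Fintype V] [DecidableEq ι]
    [DecidableEq V] (W : Finset V) :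
    (Finset.univ.filter fun f : ι ↪ V => ∀ i, f i ∈ W).card =
      W.card.descFactorial (Fintype.card ι) := by
  classical
  rw [← Fintype.card_coe W, ← Fintype.card_embedding_eq, ← Fintype.card_subtype]
  refine Fintype.card_congr ⟨fun f => ⟨fun i => ⟨f.1 i, f.2 i⟩, fun i j h => f.1.injective
    (congrArg Subtype.val h)⟩, fun f => ⟨f.trans (Function.Embedding.subtype _), fun i => (f i).2⟩,
    fun f => ?_, fun f => ?_⟩
  · ext; rfl
  · ext; rfl

/-- Factor by factor, `(w - i) / (n - i) ≤ w / n`: a random edge falls into `w` given vertices with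
probability at most `(w / n) ^ r`. -/
theorem descFactorial_mul_pow_le {w n : ℕ} (h : w ≤ n) (r : ℕ) :
    w.descFactorial r * n ^ r ≤ w ^ r * n.descFactorial r := by
  induction r with
  | zero => simp
  | succ r ih =>
    have h1 : (w - r) * n ≤ w * (n - r) := by
      rw [Nat.sub_mul, Nat.mul_sub]
      exact Nat.sub_le_sub_left (by rw [mul_comm]; exact Nat.mul_le_mul_left _ h) _
    calc w.descFactorial (r + 1) * n ^ (r + 1)
        = ((w - r) * n) * (w.descFactorial r * n ^ r) := by
          rw [Nat.descFactorial_succ]; ring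
      _ ≤ (w * (n - r)) * (w ^ r * n.descFactorial r) := Nat.mul_le_mul h1 ih
      _ = w ^ (r + 1) * n.descFactorial (r + 1) := by rw [Nat.descFactorial_succ]; ring

/-- Every factor of `a.descFactorial r` is at least `a / 2`, so a random edge falls into `a` of `a *
t` vertices with probability at least `(2 * t) ^ (-r)`. -/
theorem descFactorial_mul_le {a t r : ℕ} (ha : 2 * r ≤ a) :
    (a * t).descFactorial r ≤ (2 * t) ^ r * a.descFactorial r := by
  calc (a * t).descFactorial r ≤ (a * t) ^ r := Nat.descFactorial_le_pow _ _
    _ ≤ (2 * t * (a + 1 - r)) ^ r := by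
        refine Nat.pow_le_pow_left ?_ r
        calc a * t ≤ (2 * (a + 1 - r)) * t := Nat.mul_le_mul_right _ (by omega)
          _ = _ := by ring
    _ = (2 * t) ^ r * (a + 1 - r) ^ r := mul_pow _ _ _
    _ ≤ _ := Nat.mul_le_mul_left _ (Nat.pow_sub_le_descFactorial a r)

/-- This is `choose n w ≤ (e * n / w) ^ w` with `e ≤ 3`, free of division so that `w = 0` is
covered. -/
theorem choose_mul_pow_self_le (n w : ℕ) :
    (n.choose w : ℝ) * (w : ℝ) ^ w ≤ 3 ^ w * (n : ℝ) ^ w := by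
  have h1 : (n.choose w : ℝ) ≤ (n : ℝ) ^ w / w.factorial := Nat.choose_le_pow_div w n
  have h2 : (w : ℝ) ^ w / w.factorial ≤ 3 ^ w := by
    refine (Real.pow_div_factorial_le_exp (w : ℝ) (Nat.cast_nonneg w) w).trans ?_
    rw [← mul_one (w : ℝ), Real.exp_nat_mul]
    exact pow_le_pow_left₀ (Real.exp_pos 1).le (Real.exp_one_lt_d9.le.trans (by norm_num)) w
  calc (n.choose w : ℝ) * (w : ℝ) ^ w ≤ (n : ℝ) ^ w / w.factorial * (w : ℝ) ^ w := by gcongr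
    _ = (w : ℝ) ^ w / w.factorial * (n : ℝ) ^ w := by ring
    _ ≤ _ := by gcongr

/-- The expected number of sets of `m` edges that lie in a set of `w` vertices is small. -/
theorem choose_mul_choose_mul_le {K r q M₀ n m w : ℕ}
    (hM : 4 * 3 ^ (r + 1) * K * r ^ r ≤ M₀) (hM₀ : 1 ≤ M₀) (hm : 1 ≤ m) (hr : 1 ≤ r)
    (hn : M₀ ^ q * m ≤ n) (hw : q * w + (q + 1) * m ≤ q * (r * m)) (hq : 1 ≤ q) :
    ((K * n).choose m : ℝ) * (n.choose w * ((w : ℝ) / n) ^ (r * m)) ≤ (1 / 4) ^ m := by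
  have hwm : w + m ≤ r * m := by
    by_contra h
    have : q * (r * m) < q * (w + m) := Nat.mul_lt_mul_of_pos_left (not_le.1 h) hq
    nlinarith
  -- After the powers of `n` cancel, `(m / n) ^ u` remains. Since `q * u ≥ m` and `m / n ≤ M₀ ^
  -- (-q)`, it is at most `M₀ ^ (-m)`, which beats the other factors.
  obtain ⟨u, hu⟩ := Nat.exists_eq_add_of_le hwm
  have hqu : m ≤ q * u := by rw [hu] at hw; nlinarith
  have hn0 : 0 < n := lt_of_lt_of_le (by positivity) hn
  have hnR : (0 : ℝ) < n := by exact_mod_cast hn0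
  have hmR : (0 : ℝ) < m := by exact_mod_cast hm
  have hMR : (0 : ℝ) < M₀ := by exact_mod_cast hM₀
  have hrR : (1 : ℝ) ≤ r := by exact_mod_cast hr
  have h1 : ((K * n).choose m : ℝ) ≤ 3 ^ m * ((K : ℝ) * n) ^ m / (m : ℝ) ^ m := by
    rw [le_div_iff₀ (by positivity)]
    have := choose_mul_pow_self_le (K * n) m
    push_cast at this
    exact this
  have h2 : (n.choose w : ℝ) * ((w : ℝ) / n) ^ (r * m) ≤
      3 ^ w * (((r : ℝ) * m) / n) ^ (m + u) := by
    have hwr : (w : ℝ) ≤ r * m := by exact_mod_cast (by omega : w ≤ r * m)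
    have hcw := choose_mul_pow_self_le n w
    have : r * m = w + (m + u) := by omega
    rw [this, pow_add, div_pow (w : ℝ) (n : ℝ) w]
    calc (n.choose w : ℝ) * ((w : ℝ) ^ w / (n : ℝ) ^ w * ((w : ℝ) / n) ^ (m + u))
        = ((n.choose w : ℝ) * (w : ℝ) ^ w) / (n : ℝ) ^ w * ((w : ℝ) / n) ^ (m + u) := by ring
      _ ≤ (3 ^ w * (n : ℝ) ^ w) / (n : ℝ) ^ w * (((r : ℝ) * m) / n) ^ (m + u) := by
          exact mul_le_mul (div_le_div_of_nonneg_right hcw (by positivity)) (by gcongr)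
            (by positivity) (by positivity)
      _ = _ := by rw [mul_div_cancel_right₀ _ (by positivity)]
  have h3 : ((m : ℝ) / n) ^ u ≤ (1 / M₀) ^ m := by
    have h4 : (m : ℝ) / n ≤ (1 / M₀) ^ q := by
      rw [one_div, inv_pow, div_le_iff₀ hnR, inv_mul_eq_div, le_div_iff₀ (by positivity)]
      exact_mod_cast (by rw [mul_comm]; exact hn : m * M₀ ^ q ≤ n)
    calc ((m : ℝ) / n) ^ u ≤ ((1 / M₀) ^ q) ^ u := by gcongr
      _ = (1 / M₀ : ℝ) ^ (q * u) := by rw [pow_mul]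
      _ ≤ (1 / M₀) ^ m := by
        refine pow_le_pow_of_le_one (by positivity) ?_ hqu
        rw [div_le_one hMR]; exact_mod_cast hM₀
  calc ((K * n).choose m : ℝ) * (n.choose w * ((w : ℝ) / n) ^ (r * m))
      ≤ (3 ^ m * ((K : ℝ) * n) ^ m / (m : ℝ) ^ m) * (3 ^ w * (((r : ℝ) * m) / n) ^ (m + u)) := by
        gcongr
    _ = 3 ^ m * 3 ^ w * (K : ℝ) ^ m * (r : ℝ) ^ (m + u) * ((m : ℝ) / n) ^ u := by
        simp only [mul_pow, div_pow, pow_add]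
        field_simp
    _ ≤ 3 ^ m * 3 ^ (r * m) * (K : ℝ) ^ m * (r : ℝ) ^ (r * m) * (1 / M₀) ^ m := by
        have hwm' : w ≤ r * m := by omega
        have hum : m + u ≤ r * m := by omega
        gcongr
        norm_num
    _ = (3 ^ (r + 1) * K * r ^ r / M₀) ^ m := by
        rw [pow_mul, pow_mul]
        simp only [← mul_pow]
        congr 1
        ring
    _ ≤ (1 / 4) ^ m := by
        refine pow_le_pow_left₀ (by positivity) ?_ m
        rw [div_le_div_iff₀ hMR (by norm_num)]
        have : (4 * 3 ^ (r + 1) * K * r ^ r : ℝ) ≤ M₀ := by exact_mod_cast hM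
        linarith


theorem sum_range_quarter_pow_le (k : ℕ) :
    ∑ i ∈ Finset.range k, (1 / 4 : ℝ) ^ (i + 1) ≤ 1 / 3 * (1 - (1 / 4) ^ k) := by
  induction k with
  | zero => simp
  | succ k ih =>
    rw [Finset.sum_range_succ]
    have : (1 / 4 : ℝ) ^ (k + 1) = (1 / 4) ^ k * (1 / 4) := pow_succ _ _
    linarith

/-- Few hypergraphs have an independent set of `a` vertices. -/
theorem sum_card_avoiding_le {ι : Type*} [Fintype ι] [DecidableEq ι] {a t K : ℕ} (ha : 1 ≤ a)
    (har : 2 * Fintype.card ι ≤ a) (ht : 1 ≤ t)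
    (hK : (1 - 1 / (2 * t : ℝ) ^ Fintype.card ι) ^ K ≤ 1 / 4) :
    ∑ A ∈ Finset.powersetCard a (Finset.univ : Finset (Fin (a * t))),
      ((Fintype.piFinset fun _ : Fin (K * (a * t)) =>
        Finset.univ.filter fun f : ι ↪ Fin (a * t) => ¬ ∀ i, f i ∈ A).card : ℝ) ≤
      1 / 2 * ((a * t).descFactorial (Fintype.card ι) : ℝ) ^ (K * (a * t)) := by
  set r := Fintype.card ι with hr
  set n := a * t with hn
  have hn1 : 1 ≤ n := Nat.mul_pos ha ht
  set D := n.descFactorial r with hD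
  have htR : (1 : ℝ) ≤ t := by exact_mod_cast ht
  have hp1 : 1 / (2 * t : ℝ) ^ r ≤ 1 := by
    rw [div_le_one (by positivity)]
    exact one_le_pow₀ (by linarith)
  have hone : ∀ A ∈ Finset.powersetCard a (Finset.univ : Finset (Fin n)),
      ((Fintype.piFinset fun _ : Fin (K * n) =>
        Finset.univ.filter fun f : ι ↪ Fin n => ¬ ∀ i, f i ∈ A).card : ℝ) ≤
      (1 / 4) ^ n * (D : ℝ) ^ (K * n) := by
    intro A hA
    have hA := (Finset.mem_powersetCard.1 hA).2
    have h1 := Finset.card_filter_add_card_filter_not (s := (Finset.univ : Finset (ι ↪ Fin n)))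
      (fun f => ∀ i, f i ∈ A)
    rw [card_embedding_into, hA, Finset.card_univ, Fintype.card_embedding_eq, Fintype.card_fin,
      ← hr, ← hD] at h1
    have h2 : (D : ℝ) ≤ (2 * t) ^ r * a.descFactorial r := by
      exact_mod_cast descFactorial_mul_le har
    have h3 : ((Finset.univ.filter fun f : ι ↪ Fin n => ¬ ∀ i, f i ∈ A).card : ℝ) ≤
        (1 - 1 / (2 * t : ℝ) ^ r) * D := by
      have h1' : (a.descFactorial r : ℝ) +
        (Finset.univ.filter fun f : ι ↪ Fin n => ¬ ∀ i, f i ∈ A).card = D := by exact_mod_cast h1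
      have h4 : 1 / (2 * t : ℝ) ^ r * D ≤ a.descFactorial r := by
        rw [one_div, inv_mul_eq_div, div_le_iff₀ (by positivity)]
        linarith
      linarith
    rw [Fintype.card_piFinset, Finset.prod_const, Finset.card_univ, Fintype.card_fin]
    push_cast
    calc _ ≤ ((1 - 1 / (2 * t : ℝ) ^ r) * D) ^ (K * n) := by gcongr
      _ = ((1 - 1 / (2 * t : ℝ) ^ r) ^ K) ^ n * (D : ℝ) ^ (K * n) := by rw [mul_pow, pow_mul]
      _ ≤ _ := by
        gcongr
  refine (Finset.sum_le_sum hone).trans ?_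
  rw [Finset.sum_const, Finset.card_powersetCard, Finset.card_univ, Fintype.card_fin, nsmul_eq_mul,
    ← mul_assoc]
  gcongr
  -- Union bound: at most `2 ^ n` sets `A`, each edge-free with probability at most `4 ^ (-n)`.
  have h5 : (n.choose a : ℝ) ≤ 2 ^ n := by exact_mod_cast Nat.choose_le_two_pow n a
  calc (n.choose a : ℝ) * (1 / 4) ^ n ≤ 2 ^ n * (1 / 4) ^ n := by gcongr
    _ = (1 / 2) ^ n := by rw [← mul_pow]; norm_num
    _ ≤ (1 / 2) ^ 1 := pow_le_pow_of_le_one (by norm_num) (by norm_num) hn1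
    _ = 1 / 2 := pow_one _

/-- Few hypergraphs have `m` edges that lie in a set of `w` vertices. -/
theorem sum_sum_card_inside_le {ι : Type*} [Fintype ι] [DecidableEq ι] {K q M₀ n m w : ℕ}
    (hM : 4 * 3 ^ (Fintype.card ι + 1) * K * Fintype.card ι ^ Fintype.card ι ≤ M₀)
    (hM₀ : 1 ≤ M₀) (hm : 1 ≤ m) (hr : 1 ≤ Fintype.card ι) (hwn : w ≤ n)
    (hn : M₀ ^ q * m ≤ n) (hw : q * w + (q + 1) * m ≤ q * (Fintype.card ι * m)) (hq : 1 ≤ q) :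
    ∑ F ∈ Finset.powersetCard m (Finset.univ : Finset (Fin (K * n))),
      ∑ W ∈ Finset.powersetCard w (Finset.univ : Finset (Fin n)),
      ((Fintype.piFinset fun j : Fin (K * n) => if j ∈ F then
        Finset.univ.filter fun f : ι ↪ Fin n => ∀ i, f i ∈ W else Finset.univ).card : ℝ) ≤
      (1 / 4) ^ m * (n.descFactorial (Fintype.card ι) : ℝ) ^ (K * n) := by
  have hmain := choose_mul_choose_mul_le hM hM₀ hm hr hn hw hq
  set r := Fintype.card ι with hr
  set D := n.descFactorial r with hD
  have hn0 : 0 < n := lt_of_lt_of_le (by positivity) hn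
  have hnR : (0 : ℝ) < n := by exact_mod_cast hn0
  have hone : ∀ F ∈ Finset.powersetCard m (Finset.univ : Finset (Fin (K * n))),
      ∀ W ∈ Finset.powersetCard w (Finset.univ : Finset (Fin n)),
      ((Fintype.piFinset fun j : Fin (K * n) => if j ∈ F then
        Finset.univ.filter fun f : ι ↪ Fin n => ∀ i, f i ∈ W else Finset.univ).card : ℝ) ≤
      ((w : ℝ) / n) ^ (r * m) * (D : ℝ) ^ (K * n) := by
    intro F hF W hW
    have hF := (Finset.mem_powersetCard.1 hF).2
    have hW := (Finset.mem_powersetCard.1 hW).2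
    have h1 : ∀ j, (if j ∈ F then
        Finset.univ.filter fun f : ι ↪ Fin n => ∀ i, f i ∈ W else Finset.univ).card =
        if j ∈ F then w.descFactorial r else D := by
      intro j
      split_ifs
      · rw [card_embedding_into, hW]
      · rw [Finset.card_univ, Fintype.card_embedding_eq, Fintype.card_fin]
    have h2 : (w.descFactorial r : ℝ) ≤ ((w : ℝ) / n) ^ r * D := by
      have : (w.descFactorial r : ℝ) * (n : ℝ) ^ r ≤ (w : ℝ) ^ r * D := by
        exact_mod_cast descFactorial_mul_pow_le hwn r
      rw [div_pow, div_mul_eq_mul_div, le_div_iff₀ (by positivity)]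
      exact this
    have hmN : m ≤ K * n := by
      have := Finset.card_le_univ F
      rwa [hF, Fintype.card_fin] at this
    rw [Fintype.card_piFinset, Finset.prod_congr rfl fun j _ => h1 j, Finset.prod_ite,
      Finset.prod_const, Finset.prod_const, Finset.filter_mem_eq_inter, Finset.univ_inter,
      Finset.filter_notMem_eq_sdiff, Finset.card_sdiff_of_subset (Finset.subset_univ _), hF,
      Finset.card_univ, Fintype.card_fin]
    push_cast
    calc (w.descFactorial r : ℝ) ^ m * (D : ℝ) ^ (K * n - m)
        ≤ (((w : ℝ) / n) ^ r * D) ^ m * (D : ℝ) ^ (K * n - m) := by gcongr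
      _ = ((w : ℝ) / n) ^ (r * m) * ((D : ℝ) ^ m * (D : ℝ) ^ (K * n - m)) := by
        rw [mul_pow, ← pow_mul, mul_assoc]
      _ = _ := by rw [← pow_add, Nat.add_sub_cancel' hmN]
  refine (Finset.sum_le_sum fun F hF => Finset.sum_le_sum fun W hW => hone F hF W hW).trans ?_
  simp only [Finset.sum_const, Finset.card_powersetCard, Finset.card_univ, Fintype.card_fin,
    nsmul_eq_mul]
  calc _ = ((K * n).choose m : ℝ) * (n.choose w * ((w : ℝ) / n) ^ (r * m)) *
        (D : ℝ) ^ (K * n) := by ring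
    _ ≤ _ := by gcongr

/-- There are hypergraphs in which every set of a `t`-th of the vertices contains an edge, and in
which every set of few edges spans many vertices. -/
theorem exists_sparse_hypergraph (ι : Type*) [Fintype ι] {t q : ℕ} (ht : 1 ≤ t) (hq : 2 ≤ q)
    (hr : 2 ≤ Fintype.card ι) :
    ∃ M a₀ : ℕ, 1 ≤ M ∧ ∀ a, a₀ ≤ a → ∃ (N : ℕ) (e : Fin N → ι ↪ Fin (a * t)),
      (∀ A : Finset (Fin (a * t)), A.card = a → ∃ j, ∀ i, e j i ∈ A) ∧
      ∀ F : Finset (Fin N), M * F.card ≤ a * t →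
        q * (Fintype.card ι * F.card) ≤ q * (vertices e F).card + (q + 1) * F.card := by
  classical
  have htR : (1 : ℝ) ≤ t := by exact_mod_cast ht
  obtain ⟨K, hK⟩ : ∃ K : ℕ, (1 - 1 / (2 * t : ℝ) ^ Fintype.card ι) ^ K < 1 / 4 := by
    refine exists_pow_lt_of_lt_one (by norm_num) ?_
    have : 0 < 1 / (2 * t : ℝ) ^ Fintype.card ι := by positivity
    linarith
  set r := Fintype.card ι with hrdef
  -- The summand `r` makes `M₀` positive and ensures `w m ≤ r * m ≤ n` below.
  obtain ⟨M₀, hM₀⟩ : ∃ M₀, M₀ = 4 * 3 ^ (r + 1) * K * r ^ r + r := ⟨_, rfl⟩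
  have hM₀r : r ≤ M₀ := by rw [hM₀]; exact Nat.le_add_left _ _
  have hrM : r ≤ M₀ ^ q := hM₀r.trans (Nat.le_self_pow (by omega) M₀)
  refine ⟨M₀ ^ q, 2 * r, by omega, fun a ha => ⟨K * (a * t), ?_⟩⟩
  have hA := sum_card_avoiding_le (ι := ι) (by omega) ha ht hK.le
  rw [← hrdef] at hA
  have hrn : r ≤ a * t := by nlinarith
  generalize hn : a * t = n at *
  set D := n.descFactorial r with hD
  have hD0 : 0 < D := Nat.descFactorial_pos.2 hrn
  -- For `m ≥ 1`, the largest number of vertices violating sparsity for `m` edges; the `- 1`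
  -- reflects the strict inequality.
  let w : ℕ → ℕ := fun m => (q * (r * m) - (q + 1) * m - 1) / q
  let B₁ : Finset (Fin (K * n) → ι ↪ Fin n) :=
    (Finset.powersetCard a (Finset.univ : Finset (Fin n))).biUnion fun A =>
      Fintype.piFinset fun _ => Finset.univ.filter fun f : ι ↪ Fin n => ¬ ∀ i, f i ∈ A
  let B₂ : Finset (Fin (K * n) → ι ↪ Fin n) :=
    (Finset.range (n / M₀ ^ q)).biUnion fun m =>
      (Finset.powersetCard (m + 1) (Finset.univ : Finset (Fin (K * n)))).biUnion fun F =>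
        (Finset.powersetCard (w (m + 1)) (Finset.univ : Finset (Fin n))).biUnion fun W =>
          Fintype.piFinset fun j => if j ∈ F then
            Finset.univ.filter fun f : ι ↪ Fin n => ∀ i, f i ∈ W else Finset.univ
  have hmM : ∀ m, m ∈ Finset.range (n / M₀ ^ q) ↔ M₀ ^ q * (m + 1) ≤ n := by
    intro m
    rw [Finset.mem_range, ← Nat.add_one_le_iff, Nat.le_div_iff_mul_le (by omega), mul_comm]
  have hwq : ∀ m, 1 ≤ m → q * w m + (q + 1) * m + 1 ≤ q * (r * m) := by
    intro m hm
    have h1 : q * w m ≤ q * (r * m) - (q + 1) * m - 1 := Nat.mul_div_le _ _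
    have h2 : q * (2 * m) ≤ q * (r * m) := Nat.mul_le_mul_left _ (Nat.mul_le_mul_right _ hr)
    have h3 : 2 * m ≤ q * m := Nat.mul_le_mul_right _ hq
    have h4 : q * (2 * m) = 2 * (q * m) := by ring
    have h5 : (q + 1) * m = q * m + m := by ring
    omega
  have hwn : ∀ m, M₀ ^ q * m ≤ n → w m ≤ n := by
    intro m hm
    refine le_trans ?_ ((Nat.mul_le_mul_right m hrM).trans hm)
    refine Nat.div_le_of_le_mul ?_
    omega
  have hB₁ : (B₁.card : ℝ) ≤ 1 / 2 * (D : ℝ) ^ (K * n) := by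
    refine le_trans ?_ hA
    exact_mod_cast Finset.card_biUnion_le
  have hB₂ : (B₂.card : ℝ) ≤ 1 / 3 * (D : ℝ) ^ (K * n) := by
    have h1 : (B₂.card : ℝ) ≤ ∑ m ∈ Finset.range (n / M₀ ^ q),
        (1 / 4) ^ (m + 1) * (D : ℝ) ^ (K * n) := by
      have h2 : B₂.card ≤ _ := Finset.card_biUnion_le
      refine (Nat.cast_le.2 h2).trans ?_
      push_cast
      refine Finset.sum_le_sum fun m hm => ?_
      rw [hmM] at hm
      refine le_trans ?_ (sum_sum_card_inside_le (ι := ι) (w := w (m + 1)) (by rw [hM₀]; exact Nat.le_add_right _ _) (by omega)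
        (by omega) (by omega) (hwn _ hm) hm
        ((Nat.le_succ _).trans (hwq _ (by omega))) (by omega))
      have h3 := Finset.card_biUnion_le (s := Finset.powersetCard (m + 1)
        (Finset.univ : Finset (Fin (K * n)))) (t := fun F =>
        (Finset.powersetCard (w (m + 1)) (Finset.univ : Finset (Fin n))).biUnion fun W =>
          Fintype.piFinset fun j => if j ∈ F then
            Finset.univ.filter fun f : ι ↪ Fin n => ∀ i, f i ∈ W else Finset.univ)
      have h4 := h3.trans (Finset.sum_le_sum fun F _ => Finset.card_biUnion_le)
      exact_mod_cast h4
    refine h1.trans ?_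
    rw [← Finset.sum_mul]
    have h5 := sum_range_quarter_pow_le (n / M₀ ^ q)
    have h6 : (0 : ℝ) ≤ (1 / 4) ^ (n / M₀ ^ q) := by positivity
    gcongr
    linarith
  -- The bad events have total probability at most `1/2 + 1/3 < 1`.
  have hlt : (B₁ ∪ B₂).card < (Finset.univ : Finset (Fin (K * n) → ι ↪ Fin n)).card := by
    rw [Finset.card_univ, Fintype.card_fun, Fintype.card_embedding_eq, Fintype.card_fin,
      Fintype.card_fin, ← hrdef, ← hD]
    have h1 : ((B₁ ∪ B₂).card : ℝ) ≤ B₁.card + B₂.card := by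
      exact_mod_cast Finset.card_union_le _ _
    have h2 : (0 : ℝ) < (D : ℝ) ^ (K * n) := by positivity
    have h3 : ((B₁ ∪ B₂).card : ℝ) < (D : ℝ) ^ (K * n) := by linarith
    exact_mod_cast h3
  obtain ⟨e, -, he⟩ := Finset.exists_mem_notMem_of_card_lt_card hlt
  rw [Finset.mem_union, not_or] at he
  refine ⟨e, fun A hA => ?_, fun F hF => ?_⟩
  · by_contra hcon
    refine he.1 (Finset.mem_biUnion.2 ⟨A, Finset.mem_powersetCard.2 ⟨Finset.subset_univ _, hA⟩,
      Fintype.mem_piFinset.2 fun j => Finset.mem_filter.2 ⟨Finset.mem_univ _, fun h => ?_⟩⟩)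
    exact hcon ⟨j, h⟩
  · by_contra hcon
    rw [not_le] at hcon
    obtain ⟨m, hm⟩ : ∃ m, F.card = m + 1 := by
      refine Nat.exists_eq_succ_of_ne_zero fun h0 => ?_
      simp [h0] at hcon
    rw [hm] at hF hcon
    have hVw : (vertices e F).card ≤ w (m + 1) := by
      rw [Nat.le_div_iff_mul_le (by omega), mul_comm]
      omega
    obtain ⟨W, hVW, -, hW⟩ := Finset.exists_subsuperset_card_eq (Finset.subset_univ (vertices e F))
      hVw (by rw [Finset.card_univ, Fintype.card_fin]; exact hwn _ hF)
    refine he.2 (Finset.mem_biUnion.2 ⟨m, (hmM m).2 hF, Finset.mem_biUnion.2 ⟨F,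
      Finset.mem_powersetCard.2 ⟨Finset.subset_univ _, hm⟩, Finset.mem_biUnion.2 ⟨W,
      Finset.mem_powersetCard.2 ⟨Finset.subset_univ _, hW⟩, Fintype.mem_piFinset.2 fun j => ?_⟩⟩⟩)
    split_ifs with hj
    · refine Finset.mem_filter.2 ⟨Finset.mem_univ _, fun i => hVW ?_⟩
      exact Finset.mem_biUnion.2 ⟨j, hj, Finset.mem_map_of_mem _ (Finset.mem_univ _)⟩
    · exact Finset.mem_univ _

end Counting

/-! ### Hypergraph instances, their strategies and the conclusion. -/

/-- The structure with the vertices of a hypergraph as its elements, whose relations are such that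
every edge lies in the product of the relations. -/
@[reducible] def hypergraphStructure (L : FirstOrder.Language) [L.IsRelational] {V E : Type*}
    (e : E → Coord L ↪ V) : L.Structure V where
  funMap f _ := isEmptyElim f
  RelMap {n} R t := ∃ j, ∀ i, t i = e j ⟨⟨n, R⟩, i⟩

theorem exists_mem_of_comp_eq_univ {L : FirstOrder.Language} {S : Type*} [L.Structure S]
    (hcomp : ∀ U ∈ binaryProjections L S, ∀ V ∈ binaryProjections L S,
      SetRel.comp U V = Set.univ) (i j i' j' : Coord L) (h : i ≠ j) (h' : i' ≠ j') (a b : S) :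
    ∃ t₁ ∈ prodRel L S, ∃ t₂ ∈ prodRel L S, t₁ i = a ∧ t₁ j = t₂ i' ∧ t₂ j' = b := by
  have hab : (a, b) ∈ SetRel.comp (binaryProj (prodRel L S) i j)
      (binaryProj (prodRel L S) i' j') := by
    rw [hcomp _ ⟨i, j, h, rfl⟩ _ ⟨i', j', h', rfl⟩]
    trivial
  obtain ⟨c, ⟨t₁, ht₁, h1, h2⟩, ⟨t₂, ht₂, h3, h4⟩⟩ := hab
  exact ⟨t₁, ht₁, t₂, ht₂, h1, h2.trans h3.symm, h4⟩

/-- Locally sparse hypergraphs admit strategies. -/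
theorem consistent_hypergraphStructure {L : FirstOrder.Language} [L.IsRelational]
    [Fintype (Coord L)] [Nontrivial (Coord L)] {S V E : Type*} [Fintype S] [Nonempty S]
    [L.Structure S] [Finite V] [DecidableEq V] (e : E → Coord L ↪ V) {q k B : ℕ}
    (hq : q = 12 * (Fintype.card (Coord L) + 1))
    (hcomp : ∀ U ∈ binaryProjections L S, ∀ V ∈ binaryProjections L S,
      SetRel.comp U V = Set.univ)
    (hsparse : ∀ F : Finset E, F.card ≤ B → q * (Fintype.card (Coord L) * F.card) ≤
      q * (vertices e F).card + (q + 1) * F.card)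
    (hB : Fintype.card S * (q * (k + 1)) ≤ B) :
    letI := hypergraphStructure L e
    Consistent L k V S := by
  classical
  let := hypergraphStructure L e
  have hP := exists_mem_of_comp_eq_univ hcomp
  have hS : 1 ≤ Fintype.card S := Fintype.card_pos
  have hext : ∀ (X : Set V) (h : X → S), X.ncard ≤ k →
      (∀ F : Finset E, F.card ≤ q * (k + 1) → Extends e (prodRel L S) X h F) →
      ∀ F : Finset E, F.card ≤ B → Extends e (prodRel L S) X h F := by
    intro X
    lift X to Finset V using X.toFinite
    intro h hX hF
    rw [Set.ncard_coe_finset] at hX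
    exact Extends.of_forall_card_le hq hP hsparse fun G hG =>
      hF G (hG.trans (Nat.mul_le_mul_left _ (hX.trans (Nat.le_succ k))))
  -- With `k + 1` in place of `k`, single edges are covered even for `k = 0`, so members are partial
  -- homomorphisms.
  refine ⟨fun X => {h | X.ncard ≤ k ∧
    ∀ F : Finset E, F.card ≤ q * (k + 1) → Extends e (prodRel L S) X h F}, ?_, ?_, ?_, ?_⟩
  · refine ⟨((∅ : Finset V) : Set V), fun x => absurd x.2 (by simp), by simp, fun F hF => ?_⟩
    refine Extends.of_forall_card_le hq hP hsparse (fun G hG => ?_) F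
      (hF.trans (le_trans (Nat.le_mul_of_pos_left _ hS) hB))
    rw [Finset.card_empty, mul_zero, Nat.le_zero, Finset.card_eq_zero] at hG
    subst hG
    exact ⟨fun _ => Classical.arbitrary S, fun x => absurd x.2 (by simp), by simp⟩
  · rintro X h ⟨-, hF⟩ n R t ⟨j, hj⟩
    obtain ⟨g, hg, hgP⟩ := hF {j} (by rw [Finset.card_singleton, hq]; nlinarith)
    have := hgP j (Finset.mem_singleton_self j) ⟨n, R⟩
    have heq : (fun i => h (t i)) = fun i => g (e j ⟨⟨n, R⟩, i⟩) :=
      funext fun i => by rw [← hj, hg]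
    rw [heq]
    exact this
  · rintro X Y hYX h ⟨hX, hF⟩
    refine ⟨(Set.ncard_le_ncard hYX X.toFinite).trans hX, fun F hF' => ?_⟩
    obtain ⟨g, hg, hgP⟩ := hF F hF'
    exact ⟨g, fun x => hg (Set.inclusion hYX x), hgP⟩
  · rintro X h ⟨hX, hF⟩ hlt x hx
    let f : S → ↥(insert x X) → S := fun b y => if hy : (y : V) ∈ X then h ⟨y, hy⟩ else b
    have hfX : ∀ b, f b ∘ Set.inclusion (Set.subset_insert x X) = h := fun b =>
      funext fun y => dif_pos y.2
    by_contra hcon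
    have hbad : ∀ b, ∃ F : Finset E, F.card ≤ q * (k + 1) ∧
        ¬ Extends e (prodRel L S) (insert x X) (f b) F := by
      intro b
      by_contra hb
      push Not at hb
      exact hcon ⟨f b, ⟨(Set.ncard_insert_le x X).trans hlt, hb⟩, hfX b⟩
    -- If each value `b` at `x` failed on some `F b`, an extension `g` satisfying the union of all
    -- `F b`, which has at most `B` edges, would refute the failure of `g x`.
    choose F hFc hFn using hbad
    obtain ⟨g, hg, hgP⟩ := hext X h hX hF (Finset.univ.biUnion F) (by
      refine (Finset.card_biUnion_le_card_mul _ _ _ fun b _ => hFc b).trans ?_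
      rwa [Finset.card_univ])
    refine hFn (g x) ⟨g, fun y => ?_, fun j hj =>
      hgP j (Finset.mem_biUnion.2 ⟨g x, Finset.mem_univ _, hj⟩)⟩
    by_cases hy : (y : V) ∈ X
    · simp only [f, dif_pos hy]
      exact hg ⟨y, hy⟩
    · simp only [f, dif_neg hy]
      rw [Set.mem_insert_iff.1 y.2 |>.resolve_right hy]

/-- A homomorphism from a hypergraph with no large independent sets is constant on an edge. -/
theorem isReflexive_of_hom {L : FirstOrder.Language} [L.IsRelational] {T V E : Type*} [Fintype T]
    [Nonempty T] [Fintype V] [L.Structure T] (e : E → Coord L ↪ V) {a : ℕ}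
    (hV : Fintype.card T * a ≤ Fintype.card V)
    (hA : ∀ A : Finset V, A.card = a → ∃ j, ∀ i, e j i ∈ A)
    (h : letI := hypergraphStructure L e; Nonempty (V →[L] T)) : IsReflexive L T := by
  classical
  let := hypergraphStructure L e
  obtain ⟨f⟩ := h
  obtain ⟨b, -, hb⟩ := Finset.exists_le_card_fiber_of_mul_le_card_of_maps_to
    (s := (Finset.univ : Finset V)) (t := (Finset.univ : Finset T)) (f := f) (n := a)
    (fun _ _ => Finset.mem_univ _) Finset.univ_nonempty (by rwa [Finset.card_univ, Finset.card_univ])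
  obtain ⟨A, hAsub, hAcard⟩ := Finset.exists_subset_card_eq hb
  obtain ⟨j, hj⟩ := hA A hAcard
  refine ⟨b, fun n R => ?_⟩
  have hR : Structure.RelMap R fun i => e j ⟨⟨n, R⟩, i⟩ := ⟨j, fun i => rfl⟩
  have hT := f.map_rel R _ hR
  have heq : (f ∘ fun i => e j ⟨⟨n, R⟩, i⟩) = fun _ => b :=
    funext fun i => (Finset.mem_filter.1 (hAsub (hj ⟨⟨n, R⟩, i⟩))).2
  rwa [heq] at hT

/-- At most one symbol has positive arity, and that arity is one, so every tuple in a relation is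
already constant. -/
theorem isReflexive_of_subsingleton {L : FirstOrder.Language} {T : Type*} [Nonempty T]
    [L.Structure T] [Subsingleton (Coord L)]
    (h : ∀ (n : ℕ) (R : L.Relations n), ∃ t : Fin n → T, Structure.RelMap R t) :
    IsReflexive L T := by
  rcases isEmpty_or_nonempty (Coord L) with hemp | ⟨⟨⟨n₀, R₀⟩, i₀⟩⟩
  · refine ⟨Classical.arbitrary T, fun n R => ?_⟩
    obtain ⟨t, ht⟩ := h n R
    rwa [show (fun _ => Classical.arbitrary T) = t from
      funext fun i => (hemp.false ⟨⟨n, R⟩, i⟩).elim]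
  · obtain ⟨t₀, ht₀⟩ := h n₀ R₀
    refine ⟨t₀ i₀, fun n R => ?_⟩
    obtain ⟨t, ht⟩ := h n R
    rcases isEmpty_or_nonempty (Fin n) with hn | ⟨⟨i⟩⟩
    · rwa [show (fun _ => t₀ i₀) = t from funext fun i => (hn.false i).elim]
    · have heq : (⟨⟨n, R⟩, i⟩ : Coord L) = ⟨⟨n₀, R₀⟩, i₀⟩ := Subsingleton.elim _ _
      obtain ⟨h1, -⟩ := Sigma.mk.inj_iff.1 heq
      cases h1
      rwa [show (fun _ => t₀ i₀) = t₀ from funext fun i' => by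
        have h2 : (⟨⟨n₀, R₀⟩, i'⟩ : Coord L) = ⟨⟨n₀, R₀⟩, i₀⟩ := Subsingleton.elim _ _
        rw [eq_of_heq (Sigma.mk.inj_iff.1 h2).2] ]

theorem HasBoundedWidth.hasSublinearWidth {L : FirstOrder.Language} {S T : Type*} [L.Structure S]
    [L.Structure T] (h : HasBoundedWidth L S T) : HasSublinearWidth L S T := by
  obtain ⟨k, hk, hw⟩ := h
  refine ⟨k, hk.trans_isLittleO ?_, hw⟩
  exact (Asymptotics.isLittleO_const_left.2
    (Or.inr (tendsto_norm_atTop_atTop.comp tendsto_natCast_atTop_atTop)))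

theorem HasSublinearWidth.isReflexive {L : FirstOrder.Language} (hL : IsFiniteSignature L)
    {S T : Type*} [Finite S] [Nonempty S] [Finite T] [Nonempty T] [L.Structure S] [L.Structure T]
    [Nontrivial (Coord L)]
    (hcomp : ∀ U ∈ binaryProjections L S, ∀ V ∈ binaryProjections L S,
      SetRel.comp U V = Set.univ) (h : HasSublinearWidth L S T) : IsReflexive L T := by
  classical
  have := hL.relational
  have := hL.finite
  have := Fintype.ofFinite (Coord L)
  have := Fintype.ofFinite S
  have := Fintype.ofFinite T
  obtain ⟨k, hk, hw⟩ := h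
  have ht : 1 ≤ Fintype.card T := Fintype.card_pos
  obtain ⟨q, hq⟩ : ∃ q, q = 12 * (Fintype.card (Coord L) + 1) := ⟨_, rfl⟩
  obtain ⟨M, a₀, hM, hex⟩ := exists_sparse_hypergraph (Coord L) (t := Fintype.card T) (q := q) ht
    (by omega) Fintype.one_lt_card
  set C := M * (Fintype.card S * q) with hC
  have hC0 : 1 ≤ C := Nat.mul_pos hM (Nat.mul_pos Fintype.card_pos (by omega))
  have hlarge : ∀ᶠ n : ℕ in atTop, C * (k n + 1) ≤ n := by
    -- Half of `n` bounds `C * k n`, the other half the additional `C`.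
    have h1 := hk.def (c := 1 / (2 * C)) (by positivity)
    filter_upwards [h1, eventually_ge_atTop (2 * C)] with n hn hn'
    have hCR : (0 : ℝ) < C := by exact_mod_cast hC0
    rw [Real.norm_natCast, Real.norm_natCast, one_div, inv_mul_eq_div,
      le_div_iff₀ (by positivity)] at hn
    have hn : k n * (2 * C) ≤ n := by exact_mod_cast hn
    nlinarith
  obtain ⟨n₀, hn₀⟩ := eventually_atTop.1 hlarge
  obtain ⟨N, e, hA, hsparse⟩ := hex (max a₀ n₀) (le_max_left _ _)
  have hnn₀ : n₀ ≤ max a₀ n₀ * Fintype.card T := (le_max_right a₀ n₀).trans (Nat.le_mul_of_pos_right _ ht)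
  generalize hn : max a₀ n₀ * Fintype.card T = n at e hA hsparse hnn₀
  refine isReflexive_of_hom e (by rw [Fintype.card_fin, ← hn, mul_comm]) hA ?_
  let := hypergraphStructure L e
  refine hw (Fin n) ?_
  rw [Nat.card_eq_fintype_card, Fintype.card_fin]
  refine consistent_hypergraphStructure e (B := Fintype.card S * (q * (k n + 1))) hq hcomp
    (fun F hF => hsparse F ?_) le_rfl
  calc M * F.card ≤ M * (Fintype.card S * (q * (k n + 1))) := Nat.mul_le_mul_left _ hF
    _ = C * (k n + 1) := by rw [hC]; ring
    _ ≤ n := hn₀ n hnn₀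

end PCSP

theorem theorem4p1 (L : FirstOrder.Language) (hL : PCSP.IsFiniteSignature L)
    (S T : Type*) [Finite S] [Nonempty S] [Finite T] [L.Structure S] [L.Structure T]
    (hST : Nonempty (S →[L] T))
    (hcomp : ∀ U ∈ PCSP.binaryProjections L S, ∀ V ∈ PCSP.binaryProjections L S,
      SetRel.comp U V = Set.univ)
    (hdeg : Subsingleton (PCSP.Coord L) →
      ∀ (n : ℕ) (R : L.Relations n), ∃ t : Fin n → T, Structure.RelMap R t) :
    (PCSP.HasSublinearWidth L S T → PCSP.IsReflexive L T) ∧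
      (PCSP.HasBoundedWidth L S T → PCSP.IsReflexive L T) := by
  obtain ⟨f⟩ := hST
  have : Nonempty T := ⟨f (Classical.arbitrary S)⟩
  have key : PCSP.HasSublinearWidth L S T → PCSP.IsReflexive L T := by
    intro h
    rcases subsingleton_or_nontrivial (PCSP.Coord L) with hs | hs
    · exact PCSP.isReflexive_of_subsingleton (hdeg hs)
    · exact h.isReflexive hL hcomp
  exact ⟨key, fun h => key h.hasSublinearWidth⟩
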